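/- Let $k,\ell\in\mathbb{Z}$ with $k=-\frac14(1+27\ell^2)$, where $\ell\equiv\pm1 \pmod 8$, $\ell\equiv 1\pmod 5$, $\ell\equiv 3\pmod 7$, $\ell\not\equiv\pm10\pmod{37}$, and every prime divisor $p$ of $\ell$ satisfies $p\equiv\pm1\pmod{24}$. Let $\mathcal{U}_k\subset\mathbb{A}^3_{\mathbb{Z}}$ be the affine scheme over $\mathbb{Z}$ defined by $$x^2+y^2+z^2+4(x^2y^2+y^2z^2+z^2x^2)-16x^2y^2z^2=k,$$ let $U_k=\mathcal{U}_k\times_{\mathbb{Z}}\mathbb{Q}$ (an affine open subset of a Markoff-type K3 surface in $\mathbb{P}^1\times\mathbb{P}^1\times\mathbb{P}^1$), and put $\mathcal{U}_k(\mathbf{A}_{\mathbb{Z}})=\mathcal{U}_k(\mathbb{R})\times\prod_p\mathcal{U}_k(\mathbb{Z}_p)$. Then the quaternion classes $\mathcal{A}_1=(4x^2+1,\,-2(4k+1))$ and $\mathcal{A}_2=(4y^2+1,\,-2(4k+1))$ over the function field of $U_k$ come from $\mathrm{Br}_1 U_k=\ker(\mathrm{Br}\,U_k\to\mathrm{Br}\,(U_k\times_{\mathbb{Q}}\overline{\mathbb{Q}}))$,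 and they give an algebraic Brauer--Manin obstruction to the integral Hasse principle on $\mathcal{U}_k$. That is, $\mathcal{U}_k(\mathbf{A}_{\mathbb{Z}})\neq\emptyset$, but, if $A$ is the subgroup generated by $\mathcal{A}_1$ and $\mathcal{A}_2$ and $\mathcal{U}_k(\mathbf{A}_{\mathbb{Z}})^A$ is the set of those $(P_v)_v\in\mathcal{U}_k(\mathbf{A}_{\mathbb{Z}})$ with $\sum_{v}\mathrm{inv}_v\,\mathcal{B}(P_v)=0$ in $\mathbb{Q}/\mathbb{Z}$ for all $\mathcal{B}\in A$ (the sum being over the primes and $v=\infty$), then $$\mathcal{U}_k(\mathbb{Z})\subset\mathcal{U}_k(\mathbf{A}_{\mathbb{Z}})^A=\emptyset,\qquad\text{so}\qquad \mathcal{U}_k(\mathbb{Z})=\emptyset .$$ More precisely, for every $(P_v)_v\in\mathcal{U}_k(\mathbf{A}_{\mathbb{Z}})$ there is an $i\in\{1,2\}$ such that $\mathrm{inv}_3\,\mathcal{A}_i(P_3)=\frac12$ and $\mathrm{inv}_v\,\mathcal{A}_i(P_v)=0$ for every place $v\neq3$, including $v=\infty$. -/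

import Mathlib

open scoped TensorProduct

namespace MK3

/-! ### Azumaya algebras and Brauer classes over a commutative ring -/

/-- An Azumaya algebra over `R`; its class is an element of the Brauer group of `R`. -/
structure AzumayaAlgebra (R : Type) [CommRing R] where
  carrier : Type
  [ring : Ring carrier]
  [algebra : Algebra R carrier]
  [isAzumaya : IsAzumaya R carrier]

attribute [instance] AzumayaAlgebra.ring AzumayaAlgebra.algebra AzumayaAlgebra.isAzumaya

/-- The `R`-algebra `A` is isomorphic to `End_R P` for a faithful finitely generated projective
module `P`, i.e. it is an Azumaya algebra with trivial Brauer class. Over a field this says that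
`A` is a matrix algebra. -/
def IsSplit (R : Type) [CommRing R] (A : Type) [Ring A] [Algebra R A] : Prop :=
  ∃ (P : Type) (_ : AddCommGroup P) (_ : Module R P),
    Module.Finite R P ∧ Module.Projective R P ∧ FaithfulSMul R P ∧
      Nonempty (A ≃ₐ[R] Module.End R P)

/-- Brauer equivalence over a commutative ring: `A ⊗ End P ≅ B ⊗ End Q` for faithful finitely
generated projective modules `P` and `Q`. -/
def BrauerEquivalent (R : Type) [CommRing R] (A B : Type) [Ring A] [Algebra R A]
    [Ring B] [Algebra R B] : Prop :=
  ∃ (P Q : Type) (_ : AddCommGroup P) (_ : Module R P) (_ : AddCommGroup Q) (_ : Module R Q),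
    Module.Finite R P ∧ Module.Projective R P ∧ FaithfulSMul R P ∧
    Module.Finite R Q ∧ Module.Projective R Q ∧ FaithfulSMul R Q ∧
      Nonempty (A ⊗[R] Module.End R P ≃ₐ[R] B ⊗[R] Module.End R Q)

/-- `InSubgroup S C`: the class of `C` lies in the subgroup of the Brauer group of `R` generated
by the classes of the members of `S`. The unit is the class of `R`, the product is induced by the
tensor product, and the inverse by the opposite algebra. -/
inductive InSubgroup {R : Type} [CommRing R] (S : Set (AzumayaAlgebra R)) :
    AzumayaAlgebra R → Prop
  | of (A : AzumayaAlgebra R) (hA : A ∈ S) : InSubgroup S A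
  | one (A : AzumayaAlgebra R) (e : Nonempty (A.carrier ≃ₐ[R] R)) : InSubgroup S A
  | mul (A B C : AzumayaAlgebra R) (hA : InSubgroup S A) (hB : InSubgroup S B)
      (e : Nonempty (C.carrier ≃ₐ[R] A.carrier ⊗[R] B.carrier)) : InSubgroup S C
  | inv (A C : AzumayaAlgebra R) (hA : InSubgroup S A)
      (e : Nonempty (C.carrier ≃ₐ[R] A.carrierᵐᵒᵖ)) : InSubgroup S C
  | congr (A C : AzumayaAlgebra R) (hA : InSubgroup S A)
      (e : BrauerEquivalent R A.carrier C.carrier) : InSubgroup S C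

/-- The Brauer class of `A`, restricted to the total ring of fractions `K` of `R` (the function
field, when `R` is a domain), is the class of the quaternion algebra `(a, b)`, i.e. the
`K`-algebra with generators `i, j` and relations `i² = a`, `j² = b`, `ij = -ji`. -/
def HasGenericClass {R : Type} [CommRing R] (A : AzumayaAlgebra R) (a b : R) : Prop :=
  BrauerEquivalent (FractionRing R) (FractionRing R ⊗[R] A.carrier)
    (QuaternionAlgebra (FractionRing R) (algebraMap R (FractionRing R) a) 0
      (algebraMap R (FractionRing R) b))

/-- For a `ℚ`-algebra `R` and `U = Spec R`: the class of `A` lies in `Br₁ U`, the kernel of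
`Br U → Br (U ×_ℚ ℚ̄)`. -/
def IsAlgebraicClass {R : Type} [CommRing R] [Algebra ℚ R] (A : AzumayaAlgebra R) : Prop :=
  IsSplit (R ⊗[ℚ] AlgebraicClosure ℚ) ((R ⊗[ℚ] AlgebraicClosure ℚ) ⊗[R] A.carrier)

/-- The fibre `L ⊗_R A` of `A` at an `L`-point `φ : R → L` of `Spec R` is a matrix algebra. -/
def IsSplitAt {R : Type} [CommRing R] {L : Type} [Field L] (A : AzumayaAlgebra R)
    (φ : R →+* L) : Prop :=
  letI : Algebra R L := φ.toAlgebra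
  IsSplit L (L ⊗[R] A.carrier)

open Classical in
/-- The local invariant in `ℚ/ℤ` of the fibre of `A` at an `L`-point, for `L = ℚ_p` or `L = ℝ` and
for a class whose fibre is killed by `2` (such as a quaternion class, or a sum of those). As the
invariant map of `L` is injective on the Brauer group of `L`, it is `0` when the fibre is split,
and otherwise the unique element `1/2` of order two. -/
noncomputable def localInv {R : Type} [CommRing R] {L : Type} [Field L] (A : AzumayaAlgebra R)
    (φ : R →+* L) : AddCircle (1 : ℚ) :=
  if IsSplitAt A φ then 0 else ((1 / 2 : ℚ) : AddCircle (1 : ℚ))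

/-! ### The surfaces -/

/-- The polynomial `x² + y² + z² + 4(x²y² + y²z² + z²x²) - 16x²y²z² - k`. -/
noncomputable def poly (k : ℤ) : MvPolynomial (Fin 3) ℤ :=
  MvPolynomial.X 0 ^ 2 + MvPolynomial.X 1 ^ 2 + MvPolynomial.X 2 ^ 2
    + 4 * (MvPolynomial.X 0 ^ 2 * MvPolynomial.X 1 ^ 2
      + MvPolynomial.X 1 ^ 2 * MvPolynomial.X 2 ^ 2
      + MvPolynomial.X 2 ^ 2 * MvPolynomial.X 0 ^ 2)
    - 16 * (MvPolynomial.X 0 ^ 2 * MvPolynomial.X 1 ^ 2 * MvPolynomial.X 2 ^ 2)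
    - MvPolynomial.C k

/-- `𝒰_k(S)`: the `S`-points of the affine scheme over `ℤ` defined by `poly k`. -/
def Points (k : ℤ) (S : Type) [CommRing S] : Type :=
  {P : Fin 3 → S // MvPolynomial.aeval P (poly k) = 0}

/-- The map `𝒰_k(S) → 𝒰_k(T)` induced by a ring homomorphism `S → T`. -/
def Points.map {k : ℤ} {S T : Type} [CommRing S] [CommRing T] (g : S →+* T) (P : Points k S) :
    Points k T :=
  ⟨fun i => g (P.1 i), by
    have h := congrArg g P.2
    simp only [poly, map_add, map_sub, map_mul, map_pow, MvPolynomial.aeval_X, map_ofNat,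
      map_zero, eq_intCast, map_intCast] at h ⊢
    exact h⟩

/-- The coordinate ring `ℚ[x, y, z] / (poly k)` of the generic fibre `U_k` of `𝒰_k`. -/
abbrev CoordRing (k : ℤ) : Type :=
  MvPolynomial (Fin 3) ℚ ⧸ Ideal.span {MvPolynomial.map (Int.castRingHom ℚ) (poly k)}

/-- The coordinate functions `x, y, z` (for `i = 0, 1, 2`) on `U_k`. -/
noncomputable def coord (k : ℤ) (i : Fin 3) : CoordRing k :=
  Ideal.Quotient.mk _ (MvPolynomial.X i)

/-- The evaluation homomorphism `ℚ[U_k] → L` at a point with coordinates in `L ⊇ ℚ`. -/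
noncomputable def evalHom {k : ℤ} {L : Type} [Field L] [Algebra ℚ L] (P : Points k L) :
    CoordRing k →+* L :=
  Ideal.Quotient.lift _ (MvPolynomial.aeval P.1 : MvPolynomial (Fin 3) ℚ →ₐ[ℚ] L).toRingHom (by
    have h : ∀ a ∈ Ideal.span {MvPolynomial.map (Int.castRingHom ℚ) (poly k)},
        a ∈ RingHom.ker (MvPolynomial.aeval P.1 : MvPolynomial (Fin 3) ℚ →ₐ[ℚ] L).toRingHom := by
      intro a ha
      refine (Ideal.span_le.2 ?_) ha
      rintro _ rfl
      have h2 := P.2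
      simp only [poly, map_add, map_sub, map_mul, map_pow, MvPolynomial.aeval_X,
        map_ofNat, MvPolynomial.aeval_C] at h2
      simpa [poly, RingHom.mem_ker] using h2
    intro a ha
    exact h a ha)

/-! ### Adelic points and the Brauer–Manin set -/

instance (p : Nat.Primes) : Fact (p : ℕ).Prime := ⟨p.2⟩

/-- `𝒰_k(A_ℤ) = ∏_p 𝒰_k(ℤ_p) × 𝒰_k(ℝ)`. -/
structure AdelicPoints (k : ℤ) where
  fin : ∀ p : Nat.Primes, Points k ℤ_[(p : ℕ)]
  inf : Points k ℝ

/-- The invariant `inv_p A(P_p)` at a prime `p`. -/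
noncomputable def invFin {k : ℤ} (A : AzumayaAlgebra (CoordRing k)) (P : AdelicPoints k)
    (p : Nat.Primes) : AddCircle (1 : ℚ) :=
  localInv A (evalHom ((P.fin p).map (PadicInt.Coe.ringHom (p := (p : ℕ)))))

/-- The invariant `inv_∞ A(P_∞)` at the real place. -/
noncomputable def invInf {k : ℤ} (A : AzumayaAlgebra (CoordRing k)) (P : AdelicPoints k) :
    AddCircle (1 : ℚ) :=
  localInv A (evalHom P.inf)

/-- The Brauer–Manin pairing of `P` with `A`, the sum of the local invariants over all places. -/
noncomputable def pairing {k : ℤ} (A : AzumayaAlgebra (CoordRing k)) (P : AdelicPoints k) :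
    AddCircle (1 : ℚ) :=
  invInf A P + ∑ᶠ p : Nat.Primes, invFin A P p

/-- The Brauer–Manin set: the adelic points orthogonal to the subgroup generated by the classes in
`S` (used for classes killed by `2`). Constant
classes pair to zero with every point, so this depends only on the subgroup modulo `Br₀`. -/
def brauerManinSet {k : ℤ} (S : Set (AzumayaAlgebra (CoordRing k))) : Set (AdelicPoints k) :=
  {P | ∀ C, InSubgroup S C → pairing C P = 0}

end MK3

/-! Write X = 4x² + 1, and Y, Z likewise. Everything rests on the identity (16xyz)² - 2XYZ =
-2(4k+1), valid on the surface. Its right side equals 54ℓ² = 6(3ℓ)², so the quaternion class (X,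
-2(4k+1)) is locally the class (X, 6).

The identity also makes the class unramified. The binary form Xr² + 32xyz·rs + 2YZ·s² has
discriminant -8(4k+1), a nonzero constant, so its Clifford algebra is Azumaya on all of U_k. Where X
is invertible, this algebra is (X, -2(4k+1)). Over ℚ̄ the constant becomes a square and the algebra
splits.

Local invariants of (X, 6): at ∞, X is positive. At p ≥ 5, either 6 is a square modulo p or X is a
p-adic unit: if p divides X, the identity makes 54ℓ² a square modulo p, and the primes dividing ℓ
are ±1 modulo 24, where 6 is a square anyway. At 2, k ≡ 1 modulo 4 forces x or y to be even; the
factor of that coordinate is 1 modulo 8, hence a square. At 3, k ≡ 2 forces X ≡ 2, a nonresidue,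
while 6 has odd valuation, so the invariant is 1/2. Thus one of the two classes always has
invariants summing to 1/2.

Emptiness of the integral points is proved directly by the same reciprocity, using the Jacobi symbol
(6/X) = -1. Local points are written down with Hensel's lemma.

Splitting is made concrete: an idempotent of trace 1 and norm 0 splits the algebra, and a split
algebra contains a nonzero element of square zero, which gives a zero of a ternary form. -/

namespace MK3

/-! ### Algebras with a Casimir element -/

/-- Dual bases `e`, `f` of an algebra with respect to a trace form `tr`, such that the Casimir
element `∑ e i ⊗ f i` acts on the algebra as the trace. -/
structure CasimirSystem (R A : Type) [CommRing R] [Ring A] [Algebra R A] (ι : Type)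
    [Fintype ι] where
  tr : A →ₗ[R] R
  e : ι → A
  f : ι → A
  casimir : ∀ x, ∑ i, e i * x * f i = algebraMap R A (tr x)
  expand : ∀ x, ∑ i, tr (f i * x) • e i = x
  expand' : ∀ x, ∑ i, tr (x * e i) • f i = x

namespace CasimirSystem

variable {R A : Type} [CommRing R] [Ring A] [Algebra R A] {ι : Type} [Fintype ι]

theorem finite (S : CasimirSystem R A ι) : Module.Finite R A := by
  classical
  refine Module.Finite.of_surjective (Fintype.linearCombination R S.e) fun x => ?_
  exact ⟨fun i => S.tr (S.f i * x), by simpa [Fintype.linearCombination_apply] using S.expand x⟩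

theorem projective (S : CasimirSystem R A ι) : Module.Projective R A := by
  classical
  refine Module.Projective.of_split
    (LinearMap.pi fun i => S.tr ∘ₗ LinearMap.mulLeft R (S.f i))
    (Fintype.linearCombination R S.e) ?_
  ext x
  simpa [Fintype.linearCombination_apply] using S.expand x

/-- Expanding x in the dual bases gives φ(x) = ∑ₗ tr(fₗx) φ(eₗ), and the Casimir identity turns
tr(fₗx) into ∑ₘ eₘfₗx fₘ. So φ is a sum of left-right multiplications with explicit coefficients;
this is the inverse `Ψ`. -/
theorem mulLeftRight_bijective (S : CasimirSystem R A ι) :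
    Function.Bijective (AlgHom.mulLeftRight R A) := by
  have casimir (x : A) : ∑ i, S.e i * x * S.f i = algebraMap R A (S.tr x) := S.casimir x
  let Ψ : Module.End R A →ₗ[R] A ⊗[R] Aᵐᵒᵖ :=
    ∑ l, ∑ m, ((TensorProduct.mk R A Aᵐᵒᵖ).flip (MulOpposite.op (S.f m))) ∘ₗ
      LinearMap.mulRight R (S.e m * S.f l) ∘ₗ LinearMap.applyₗ (S.e l)
  have hΨ (φ) : Ψ φ = ∑ l, ∑ m, (φ (S.e l) * (S.e m * S.f l)) ⊗ₜ MulOpposite.op (S.f m) := by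
    simp [Ψ, mul_assoc]
  refine Function.bijective_iff_has_inverse.2 ⟨Ψ, fun z => ?_, fun φ => ?_⟩
  · induction z using TensorProduct.induction_on with
    | zero => simp
    | add x y hx hy => rw [map_add, map_add, hx, hy]
    | tmul y z =>
      rw [hΨ, Finset.sum_comm]
      have key (m) : ∑ l, (AlgHom.mulLeftRight R A (y ⊗ₜ[R] z) (S.e l) * (S.e m * S.f l)) ⊗ₜ[R]
            MulOpposite.op (S.f m) =
          y ⊗ₜ[R] MulOpposite.op (S.tr (z.unop * S.e m) • S.f m) := by
        rw [← TensorProduct.sum_tmul]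
        have : ∑ l, AlgHom.mulLeftRight R A (y ⊗ₜ[R] z) (S.e l) * (S.e m * S.f l) =
            S.tr (z.unop * S.e m) • y := by
          calc _ = y * ∑ l, S.e l * (z.unop * S.e m) * S.f l := by
                rw [Finset.mul_sum]
                exact Finset.sum_congr rfl fun l _ => by simp [mul_assoc]
            _ = _ := by rw [casimir, ← Algebra.commutes, ← Algebra.smul_def]
        rw [this, MulOpposite.op_smul, TensorProduct.smul_tmul]
      rw [Finset.sum_congr rfl fun m _ => key m, ← TensorProduct.tmul_sum, ← Finset.op_sum,
        S.expand', MulOpposite.op_unop]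
  · ext x
    rw [hΨ]
    simp only [map_sum, LinearMap.sum_apply, AlgHom.mulLeftRight_apply, MulOpposite.unop_op]
    have key (l) : ∑ m, φ (S.e l) * (S.e m * S.f l) * x * S.f m =
        φ (S.tr (S.f l * x) • S.e l) := by
      calc _ = φ (S.e l) * ∑ m, S.e m * (S.f l * x) * S.f m := by
            rw [Finset.mul_sum]
            exact Finset.sum_congr rfl fun l _ => by simp [mul_assoc]
        _ = _ := by rw [casimir, ← Algebra.commutes, ← Algebra.smul_def, map_smul]
    rw [Finset.sum_congr rfl fun l _ => key l, ← map_sum, S.expand]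

theorem isAzumaya (S : CasimirSystem R A ι) [FaithfulSMul R A] : IsAzumaya R A :=
  { S.projective, S.finite, (inferInstance : FaithfulSMul R A) with
    bij := S.mulLeftRight_bijective }

/-- An algebra with a Casimir element and a rank one idempotent `ε` acts faithfully and fully
on the left ideal generated by `ε`. -/
theorem isSplit (S : CasimirSystem R A ι) (ε : A) (hε : S.tr ε = 1)
    (h : ∀ x, ε * x * ε = S.tr (x * ε) • ε) (hid : ε * ε = ε) : IsSplit R A := by
  have casimir (x : A) : ∑ i, S.e i * x * S.f i = algebraMap R A (S.tr x) := S.casimir x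
  have := S.finite
  have := S.projective
  let π : A →ₗ[R] A := LinearMap.mulRight R ε
  let P : Submodule R A := LinearMap.range π
  have hmem (x : A) : x * ε ∈ P := ⟨x, rfl⟩
  have hP (y : P) : (y : A) * ε = y := by
    obtain ⟨_, x, rfl⟩ := y
    simp [π, mul_assoc, hid]
  let r : A →ₗ[R] P := π.rangeRestrict
  have hr : r ∘ₗ P.subtype = LinearMap.id := by
    ext y
    exact hP y
  have hfin : Module.Finite R P := Module.Finite.of_surjective r fun y => ⟨y, Subtype.ext (hP y)⟩
  have hproj : Module.Projective R P := Module.Projective.of_split P.subtype r hr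
  have hfaith : FaithfulSMul R P := by
    refine ⟨fun {a b} hab => ?_⟩
    have := congrArg (fun y : P => S.tr (y : A)) (hab ⟨ε, ε, hid⟩)
    simpa [hε] using this
  have hstable (a : A) (y : A) (hy : y ∈ P) : a * y ∈ P := by
    obtain ⟨x, rfl⟩ := hy
    exact ⟨a * x, by simp [π, mul_assoc]⟩
  let Φ : A →ₐ[R] Module.End R P := AlgHom.ofLinearMap
    { toFun := fun a => (LinearMap.mulLeft R a).restrict (hstable a)
      map_add' := fun a b => by exact LinearMap.ext fun y => Subtype.ext (add_mul _ _ _)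
      map_smul' := fun c a => by
        exact LinearMap.ext fun y => Subtype.ext (smul_mul_assoc _ _ _) }
    (LinearMap.ext fun y => Subtype.ext (one_mul _))
    (fun a b => LinearMap.ext fun y => Subtype.ext (mul_assoc _ _ _))
  have hΦ (a : A) (y : P) : ((Φ a y : P) : A) = a * y := rfl
  refine ⟨P, inferInstance, inferInstance, hfin, hproj, hfaith,
    ⟨AlgEquiv.ofBijective Φ ⟨?_, fun φ => ?_⟩⟩⟩
  · refine (injective_iff_map_eq_zero Φ).2 fun a ha => ?_
    have h0 (x : A) : a * (x * ε) = 0 := by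
      rw [← hΦ a ⟨x * ε, hmem x⟩, ha]
      rfl
    -- The Casimir identity at `ε` reads ∑ eᵢεfᵢ = tr ε = 1, so an element killing the ideal Aε is
    -- zero.
    calc a = a * ∑ i, S.e i * ε * S.f i := by rw [casimir, hε, map_one, mul_one]
      _ = ∑ i, a * (S.e i * ε) * S.f i := by simp [Finset.mul_sum, mul_assoc]
      _ = 0 := by simp [h0]
  -- For y in Aε, ε(fᵢy)ε is the scalar tr(fᵢy) times ε, so this element sends y to φ(∑ tr(fᵢy) eᵢε)
  -- = φ(y).
  · refine ⟨∑ i, (φ ⟨S.e i * ε, hmem _⟩ : A) * S.f i, ?_⟩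
    ext y
    rw [hΦ, Finset.sum_mul]
    have key (i) : (φ ⟨S.e i * ε, hmem _⟩ : A) * S.f i * y =
        φ (S.tr (S.f i * y) • ⟨S.e i * ε, hmem _⟩) := by
      rw [← hP (φ _), ← hP y, map_smul, Submodule.coe_smul]
      calc _ = (φ ⟨S.e i * ε, hmem _⟩ : A) * (ε * (S.f i * y) * ε) := by simp [mul_assoc]
        _ = _ := by rw [h, mul_smul_comm, hP, hP, mul_assoc, hP]
    rw [Finset.sum_congr rfl fun i _ => key i]
    have hsum : ∑ i, S.tr (S.f i * (y : A)) • (⟨S.e i * ε, hmem _⟩ : P) = y := by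
      ext
      rw [AddSubmonoidClass.coe_finsetSum]
      calc _ = (∑ i, S.tr (S.f i * (y : A)) • S.e i) * ε := by simp [Finset.sum_mul]
        _ = _ := by rw [S.expand, hP]
    conv_rhs => rw [← hsum, map_sum]
    simp

end CasimirSystem

theorem IsSplit.of_algEquiv {R A B : Type} [CommRing R] [Ring A] [Algebra R A] [Ring B]
    [Algebra R B] (e : A ≃ₐ[R] B) (h : IsSplit R A) : IsSplit R B := by
  obtain ⟨P, _, _, h1, h2, h3, ⟨g⟩⟩ := h
  exact ⟨P, _, _, h1, h2, h3, ⟨e.symm.trans g⟩⟩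

/-! ### Clifford algebras of binary quadratic forms -/

/-- The Clifford algebra of the binary quadratic form `a r² + t r s + c s²`: the algebra generated
by `u` and `v` with `u² = a`, `v² = c` and `uv + vu = t`, in the basis `1, u, v, uv`. -/
@[ext]
structure BinaryClifford (R : Type) (a t c : R) where
  one' : R
  u : R
  v : R
  uv : R

namespace BinaryClifford

variable {R : Type} [CommRing R] {a t c : R}

instance : Zero (BinaryClifford R a t c) := ⟨⟨0, 0, 0, 0⟩⟩
instance : One (BinaryClifford R a t c) := ⟨⟨1, 0, 0, 0⟩⟩
instance : Add (BinaryClifford R a t c) :=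
  ⟨fun x y => ⟨x.one' + y.one', x.u + y.u, x.v + y.v, x.uv + y.uv⟩⟩
instance : Neg (BinaryClifford R a t c) := ⟨fun x => ⟨-x.one', -x.u, -x.v, -x.uv⟩⟩
instance : Sub (BinaryClifford R a t c) :=
  ⟨fun x y => ⟨x.one' - y.one', x.u - y.u, x.v - y.v, x.uv - y.uv⟩⟩
instance : SMul R (BinaryClifford R a t c) :=
  ⟨fun r x => ⟨r * x.one', r * x.u, r * x.v, r * x.uv⟩⟩
instance : Mul (BinaryClifford R a t c) :=
  ⟨fun x y =>
    ⟨x.one' * y.one' + a * (x.u * y.u) + t * (x.v * y.u) + c * (x.v * y.v)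
        - a * c * (x.uv * y.uv),
      x.one' * y.u + x.u * y.one' - c * (x.v * y.uv) + t * (x.uv * y.u) + c * (x.uv * y.v),
      x.one' * y.v + x.v * y.one' + a * (x.u * y.uv) + t * (x.v * y.uv) - a * (x.uv * y.u),
      x.one' * y.uv + x.uv * y.one' + x.u * y.v - x.v * y.u + t * (x.uv * y.uv)⟩⟩

variable (x y : BinaryClifford R a t c) (r : R)

@[simp] theorem zero_one' : (0 : BinaryClifford R a t c).one' = 0 := rfl
@[simp] theorem zero_u : (0 : BinaryClifford R a t c).u = 0 := rfl
@[simp] theorem zero_v : (0 : BinaryClifford R a t c).v = 0 := rfl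
@[simp] theorem zero_uv : (0 : BinaryClifford R a t c).uv = 0 := rfl
@[simp] theorem one_one' : (1 : BinaryClifford R a t c).one' = 1 := rfl
@[simp] theorem one_u : (1 : BinaryClifford R a t c).u = 0 := rfl
@[simp] theorem one_v : (1 : BinaryClifford R a t c).v = 0 := rfl
@[simp] theorem one_uv : (1 : BinaryClifford R a t c).uv = 0 := rfl
@[simp] theorem add_one' : (x + y).one' = x.one' + y.one' := rfl
@[simp] theorem add_u : (x + y).u = x.u + y.u := rfl
@[simp] theorem add_v : (x + y).v = x.v + y.v := rfl
@[simp] theorem add_uv : (x + y).uv = x.uv + y.uv := rfl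
@[simp] theorem neg_one' : (-x).one' = -x.one' := rfl
@[simp] theorem neg_u : (-x).u = -x.u := rfl
@[simp] theorem neg_v : (-x).v = -x.v := rfl
@[simp] theorem neg_uv : (-x).uv = -x.uv := rfl
@[simp] theorem sub_one' : (x - y).one' = x.one' - y.one' := rfl
@[simp] theorem sub_u : (x - y).u = x.u - y.u := rfl
@[simp] theorem sub_v : (x - y).v = x.v - y.v := rfl
@[simp] theorem sub_uv : (x - y).uv = x.uv - y.uv := rfl
@[simp] theorem smul_one' : (r • x).one' = r * x.one' := rfl
@[simp] theorem smul_u : (r • x).u = r * x.u := rfl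
@[simp] theorem smul_v : (r • x).v = r * x.v := rfl
@[simp] theorem smul_uv : (r • x).uv = r * x.uv := rfl
@[simp] theorem mul_one' : (x * y).one' = x.one' * y.one' + a * (x.u * y.u) + t * (x.v * y.u) +
    c * (x.v * y.v) - a * c * (x.uv * y.uv) := rfl
@[simp] theorem mul_u : (x * y).u = x.one' * y.u + x.u * y.one' - c * (x.v * y.uv) +
    t * (x.uv * y.u) + c * (x.uv * y.v) := rfl
@[simp] theorem mul_v : (x * y).v = x.one' * y.v + x.v * y.one' + a * (x.u * y.uv) +
    t * (x.v * y.uv) - a * (x.uv * y.u) := rfl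
@[simp] theorem mul_uv : (x * y).uv = x.one' * y.uv + x.uv * y.one' + x.u * y.v - x.v * y.u +
    t * (x.uv * y.uv) := rfl

instance : AddCommGroup (BinaryClifford R a t c) where
  add_assoc x y z := by ext <;> simp [add_assoc]
  zero_add x := by ext <;> simp
  add_zero x := by ext <;> simp
  add_comm x y := by ext <;> simp [add_comm]
  neg_add_cancel x := by ext <;> simp
  sub_eq_add_neg x y := by ext <;> simp [sub_eq_add_neg]
  nsmul := nsmulRec
  zsmul := zsmulRec

instance : Ring (BinaryClifford R a t c) where
  left_distrib x y z := by ext <;> simp <;> ring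
  right_distrib x y z := by ext <;> simp <;> ring
  zero_mul x := by ext <;> simp
  mul_zero x := by ext <;> simp
  mul_assoc x y z := by ext <;> simp <;> ring
  one_mul x := by ext <;> simp
  mul_one x := by ext <;> simp
  neg_add_cancel := neg_add_cancel
  sub_eq_add_neg := sub_eq_add_neg
  zsmul := zsmulRec

instance : Module R (BinaryClifford R a t c) where
  one_smul x := by ext <;> simp
  mul_smul r s x := by ext <;> simp [mul_assoc]
  smul_zero r := by ext <;> simp
  smul_add r x y := by ext <;> simp [mul_add]
  add_smul r s x := by ext <;> simp [add_mul]
  zero_smul x := by ext <;> simp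

instance : Algebra R (BinaryClifford R a t c) :=
  Algebra.ofModule (fun r x y => by ext <;> simp <;> ring) (fun r x y => by ext <;> simp <;> ring)

theorem algebraMap_eq (r : R) : algebraMap R (BinaryClifford R a t c) r = ⟨r, 0, 0, 0⟩ := by
  rw [Algebra.algebraMap_eq_smul_one]
  ext <;> simp

instance : FaithfulSMul R (BinaryClifford R a t c) :=
  ⟨fun h => by simpa using congrArg one' (h 1)⟩

/-- The coordinates of an element in the basis `1, u, v, uv`. -/
def coords : BinaryClifford R a t c ≃ₗ[R] (Fin 4 → R) where
  toFun x := ![x.one', x.u, x.v, x.uv]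
  invFun f := ⟨f 0, f 1, f 2, f 3⟩
  map_add' x y := by ext i; fin_cases i <;> rfl
  map_smul' r x := by ext i; fin_cases i <;> rfl
  left_inv x := rfl
  right_inv f := by ext i; fin_cases i <;> rfl

@[simp] theorem coords_apply : coords x = ![x.one', x.u, x.v, x.uv] := rfl

@[simp] theorem coords_symm_apply (f : Fin 4 → R) :
    (coords (a := a) (t := t) (c := c)).symm f = ⟨f 0, f 1, f 2, f 3⟩ := rfl

/-- The reduced trace. -/
def trace : BinaryClifford R a t c →ₗ[R] R where
  toFun x := 2 * x.one' + t * x.uv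
  map_add' x y := by simp; ring
  map_smul' r x := by simp; ring

theorem trace_apply : trace x = 2 * x.one' + t * x.uv := rfl

/-- If the discriminant of the form is invertible, `1, u, v, uv` and its dual basis for the
reduced trace form a Casimir system. -/
def casimirSystem (δ : R) (hδ : δ * (t ^ 2 - 4 * (a * c)) = 1) :
    CasimirSystem R (BinaryClifford R a t c) (Fin 4) where
  tr := trace
  e := ![⟨1, 0, 0, 0⟩, ⟨0, 1, 0, 0⟩, ⟨0, 0, 1, 0⟩, ⟨0, 0, 0, 1⟩]
  f := ![⟨δ * (t ^ 2 - 2 * (a * c)), 0, 0, -(δ * t)⟩, ⟨0, -(δ * (2 * c)), δ * t, 0⟩,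
    ⟨0, δ * t, -(δ * (2 * a)), 0⟩, ⟨-(δ * t), 0, 0, δ * 2⟩]
  casimir x := by
    rw [algebraMap_eq]
    ext <;> simp [Fin.sum_univ_four, trace_apply]
    · linear_combination (2 * x.one' + t * x.uv) * hδ
    all_goals ring
  expand x := by
    ext <;> simp [Fin.sum_univ_four, trace_apply]
    · linear_combination x.one' * hδ
    · linear_combination x.u * hδ
    · linear_combination x.v * hδ
    · linear_combination x.uv * hδ
  expand' x := by
    ext <;> simp [Fin.sum_univ_four, trace_apply]
    · linear_combination x.one' * hδ
    · linear_combination x.u * hδ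
    · linear_combination x.v * hδ
    · linear_combination x.uv * hδ

theorem isAzumaya (h : IsUnit (t ^ 2 - 4 * (a * c))) : IsAzumaya R (BinaryClifford R a t c) := by
  obtain ⟨δ, hδ⟩ := h.exists_left_inv
  exact (casimirSystem δ hδ).isAzumaya

/-- The reduced norm. -/
def norm : R :=
  x.one' ^ 2 + t * (x.one' * x.uv) - a * x.u ^ 2 - t * (x.u * x.v) - c * x.v ^ 2 +
    a * c * x.uv ^ 2

/-- Cayley–Hamilton: it reduces idempotents and nilpotents to conditions on trace and norm. -/
theorem mul_self_eq : x * x = trace x • x - norm x • 1 := by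
  ext <;> simp [trace_apply, norm] <;> ring

/-- Elements of norm zero behave like 2 × 2 matrices of rank at most one, for which xyx = tr(yx)x.
-/
theorem mul_mul_self_eq (h : norm x = 0) : x * y * x = trace (y * x) • x := by
  rw [norm] at h
  ext <;> simp [trace_apply]
  · linear_combination -(y.one' + t * y.uv) * h
  · linear_combination y.u * h
  · linear_combination y.v * h
  · linear_combination y.uv * h

theorem isSplit_of_norm_eq_zero (h : IsUnit (t ^ 2 - 4 * (a * c))) (htr : trace x = 1)
    (hn : norm x = 0) : IsSplit R (BinaryClifford R a t c) := by
  obtain ⟨δ, hδ⟩ := h.exists_left_inv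
  exact (casimirSystem δ hδ).isSplit x htr (fun y => mul_mul_self_eq x y hn)
    (by rw [mul_self_eq, htr, hn, one_smul, zero_smul, sub_zero])

/-- The Clifford algebra is split if an element of trace zero squares to `1`. -/
theorem isSplit_of_represents_one {w : R} (h : IsUnit ((2 * w) ^ 2 - 4 * (a * c)))
    (h2 : IsUnit (2 : R)) (r s q : R)
    (hr : a * r ^ 2 + 2 * w * (r * s) + c * s ^ 2 + (w ^ 2 - a * c) * q ^ 2 = 1) :
    IsSplit R (BinaryClifford R a (2 * w) c) := by
  obtain ⟨m, hm⟩ := h2.exists_left_inv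
  -- The trace-zero element g = ru + sv + q(uv - w) has square 1 by `hr`; the idempotent is (1 +
  -- g)/2.
  refine isSplit_of_norm_eq_zero ⟨m * (1 - w * q), m * r, m * s, m * q⟩ h ?_ ?_
  · rw [trace_apply]
    linear_combination hm
  · rw [norm]
    linear_combination -m ^ 2 * hr

/-- The formation of the Clifford algebra commutes with base change. -/
noncomputable def baseChange (T : Type) [CommRing T] [Algebra R T] {a' t' c' : T}
    (ha : algebraMap R T a = a') (ht : algebraMap R T t = t') (hc : algebraMap R T c = c') :
    T ⊗[R] BinaryClifford R a t c ≃ₐ[T] BinaryClifford T a' t' c' :=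
  Algebra.TensorProduct.algEquivOfLinearEquivTensorProduct
    (TensorProduct.AlgebraTensorModule.congr (LinearEquiv.refl T T) coords ≪≫ₗ
      TensorProduct.piScalarRight R T T (Fin 4) ≪≫ₗ coords.symm)
    (fun r s x y => by
      subst ha ht hc
      ext <;> simp [Algebra.smul_def] <;> ring)
    (by ext <;> simp)

/-- If `a` is invertible, the form can be diagonalised. -/
def quaternionEquiv {w b α : R} (hα : α * a = 1) (h : w ^ 2 - a * c = b) :
    QuaternionAlgebra R a 0 b ≃ₐ[R] BinaryClifford R a (2 * w) c where
  -- The generators go to i ↦ u and j ↦ uv - w; the latter anticommutes with u and has square w² -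
  -- ac.
  toFun q := ⟨q.re - w * q.imJ, q.imI - w * q.imK, a * q.imK, q.imJ⟩
  invFun x := ⟨x.one' + w * x.uv, x.u + w * (α * x.v), x.uv, α * x.v⟩
  left_inv q := by
    ext <;> simp
    · linear_combination w * q.imK * hα
    · linear_combination q.imK * hα
  right_inv x := by
    ext <;> simp
    linear_combination x.v * hα
  map_mul' p q := by
    subst h
    ext <;> simp <;> ring
  map_add' p q := by
    ext <;> simp <;> ring
  commutes' r := by
    rw [algebraMap_eq]
    ext <;> simp

/-- A split algebra of dimension 4 is End of a plane, so it contains a nonzero x with x² = 0, and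
then trace and norm of x vanish. Completing the square in the norm of trace-zero elements turns this
into a zero of m² = d(n² - ar²), with m = au + wv. -/
theorem not_isSplit {L : Type} [Field L] {a w c d : L} (h2 : (2 : L) ≠ 0) (ha : a ≠ 0)
    (hd : w ^ 2 - a * c = d)
    (h : ∀ m n r : L, m ^ 2 = d * (n ^ 2 - a * r ^ 2) → n = 0 ∧ r = 0) :
    ¬ IsSplit L (BinaryClifford L a (2 * w) c) := by
  rintro ⟨P, _, _, _, _, _, ⟨g⟩⟩
  have h4 : Module.finrank L P * Module.finrank L P = 4 := by
    rw [← Module.finrank_linearMap, ← g.toLinearEquiv.finrank_eq, coords.finrank_eq]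
    simp
  have hP : Module.finrank L P = 2 := by nlinarith
  let b := Module.finBasisOfFinrankEq L P hP
  let N : Module.End L P := LinearMap.toSpanSingleton L P (b 1) ∘ₗ b.coord 0
  have hN0 : N (b 0) = b 1 := by simp [N]
  have hN : N * N = 0 := by
    ext y
    simp [N]
  set x := g.symm N with hx
  have hxx : x * x = 0 := by rw [hx, ← map_mul, hN, map_zero]
  have hx0 : x ≠ 0 := by
    intro h0
    rw [hx, map_eq_zero_iff _ g.symm.injective] at h0
    rw [h0, LinearMap.zero_apply] at hN0
    exact b.ne_zero 1 hN0.symm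
  have hmul := mul_self_eq x
  rw [hxx] at hmul
  have hnorm : norm x = 0 := by
    by_contra hne
    have : x * (trace x • x - norm x • 1) = 0 := by rw [← hmul, mul_zero]
    rw [mul_sub, mul_smul_comm, hxx, smul_zero, zero_sub, neg_eq_zero, mul_smul_comm, mul_one,
      smul_eq_zero] at this
    exact this.elim hne hx0
  have htrace : trace x = 0 := by
    rw [hnorm, zero_smul, sub_zero, eq_comm, smul_eq_zero] at hmul
    exact hmul.resolve_right hx0
  rw [trace_apply] at htrace
  rw [norm] at hnorm
  have h0 : x.one' = -(w * x.uv) :=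
    mul_left_cancel₀ h2 (by linear_combination htrace)
  rw [h0] at hnorm
  obtain ⟨hv, huv⟩ := h (a * x.u + w * x.v) x.v x.uv (by
    subst hd
    linear_combination -a * hnorm)
  rw [hv, huv] at hnorm
  have hu : x.u = 0 := by
    have : a * x.u ^ 2 = 0 := by linear_combination -hnorm
    simpa [ha] using this
  exact hx0 (by ext <;> simp [h0, hu, hv, huv])

end BinaryClifford
end MK3

namespace MK3

/-! ### Squares and conics over the `p`-adic integers -/

section Padic

variable {p : ℕ} [Fact p.Prime]

theorem toZMod_eq_zero_iff (x : ℤ_[p]) : PadicInt.toZMod x = 0 ↔ ‖x‖ < 1 := by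
  rw [← RingHom.mem_ker, PadicInt.ker_toZMod, IsLocalRing.mem_maximalIdeal, PadicInt.mem_nonunits]

theorem norm_eq_one_of_toZMod_ne_zero {x : ℤ_[p]} (h : PadicInt.toZMod x ≠ 0) : ‖x‖ = 1 :=
  le_antisymm x.norm_le_one (not_lt.1 fun h' => h ((toZMod_eq_zero_iff x).2 h'))

theorem isUnit_of_toZMod_ne_zero {x : ℤ_[p]} (h : PadicInt.toZMod x ≠ 0) : IsUnit x :=
  PadicInt.isUnit_iff.2 (norm_eq_one_of_toZMod_ne_zero h)

theorem toZMod_surjective : Function.Surjective (PadicInt.toZMod : ℤ_[p] →+* ZMod p) :=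
  ZMod.ringHom_surjective _

theorem exists_sq_eq_of_norm_lt {a m : ℤ_[p]} (h : ‖m ^ 2 - a‖ < ‖2 * m‖ ^ 2) :
    ∃ z : ℤ_[p], z ^ 2 = a := by
  obtain ⟨z, hz, -⟩ := hensels_lemma (F := (Polynomial.X ^ 2 - Polynomial.C a : Polynomial ℤ_[p]))
    (a := m) (by simpa [one_add_one_eq_two] using h)
  exact ⟨z, by simpa [sub_eq_zero] using hz⟩

theorem two_ne_zero_zmod (hp : p ≠ 2) : (2 : ZMod p) ≠ 0 := by
  intro h
  have h2 : ((2 : ℕ) : ZMod p) = 0 := by exact_mod_cast h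
  rw [ZMod.natCast_eq_zero_iff] at h2
  exact hp ((Nat.prime_dvd_prime_iff_eq Fact.out Nat.prime_two).1 h2)

theorem exists_sq_eq_of_toZMod (hp : p ≠ 2) {a : ℤ_[p]} (ha : PadicInt.toZMod a ≠ 0)
    (h : IsSquare (PadicInt.toZMod a)) : ∃ z : ℤ_[p], z ^ 2 = a := by
  obtain ⟨m', hm'⟩ := h
  obtain ⟨m, rfl⟩ := toZMod_surjective m'
  have hm : PadicInt.toZMod m ≠ 0 := by
    intro h0
    rw [h0, mul_zero] at hm'
    exact ha hm'
  refine exists_sq_eq_of_norm_lt (m := m) ?_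
  rw [norm_eq_one_of_toZMod_ne_zero (x := 2 * m)
    (by rw [map_mul, map_ofNat]; exact mul_ne_zero (two_ne_zero_zmod hp) hm), one_pow,
    ← toZMod_eq_zero_iff, map_sub, map_pow, hm', pow_two, sub_self]

theorem exists_sq_eq_of_two_adic (b : ℤ_[2]) : ∃ z : ℤ_[2], z ^ 2 = 1 + 8 * b := by
  -- Hensel at 1 applies because |8b| ≤ 1/8 < |2|² = 1/4.
  refine exists_sq_eq_of_norm_lt (m := 1) ?_
  have h2 : ‖(2 : ℤ_[2])‖ = 2⁻¹ := by exact_mod_cast PadicInt.norm_p (p := 2)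
  have h8 : (8 : ℤ_[2]) = 2 ^ 3 := by norm_num
  have : (1 : ℤ_[2]) ^ 2 - (1 + 8 * b) = -(2 ^ 3 * b) := by rw [h8]; ring
  rw [this, norm_neg, norm_mul, norm_pow, mul_one, h2]
  have := b.norm_le_one
  nlinarith [norm_nonneg b]

theorem exists_conic_point_zmod (hp : p ≠ 2) {A B : ZMod p} (hA : A ≠ 0) (hB : B ≠ 0)
    (C : ZMod p) : ∃ m n : ZMod p, A * m ^ 2 + B * n ^ 2 = C := by
  obtain ⟨m, n, h⟩ := FiniteField.exists_root_sum_quadratic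
    (f := Polynomial.C A * Polynomial.X ^ 2 + Polynomial.C 0 * Polynomial.X + Polynomial.C (-C))
    (g := Polynomial.C B * Polynomial.X ^ 2 + Polynomial.C 0 * Polynomial.X + Polynomial.C 0)
    (Polynomial.degree_quadratic hA) (Polynomial.degree_quadratic hB)
    (by rw [ZMod.card]; exact (Fact.out : p.Prime).eq_two_or_odd.resolve_left hp)
  refine ⟨m, n, ?_⟩
  simp at h
  linear_combination h

/-- A solution modulo p exists by counting. As C is a unit, one of its coordinates is nonzero, and
Hensel's lemma adjusts that coordinate while any lift of the other is kept. -/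
theorem exists_conic_point (hp : p ≠ 2) {A B C : ℤ_[p]} (hA : PadicInt.toZMod A ≠ 0)
    (hB : PadicInt.toZMod B ≠ 0) (hC : PadicInt.toZMod C ≠ 0) :
    ∃ m n : ℤ_[p], A * m ^ 2 + B * n ^ 2 = C := by
  have lift {A B : ℤ_[p]} {m' n' : ZMod p} (hA : PadicInt.toZMod A ≠ 0)
      (h : PadicInt.toZMod A * m' ^ 2 + PadicInt.toZMod B * n' ^ 2 = PadicInt.toZMod C)
      (hm : m' ≠ 0) : ∃ m n : ℤ_[p], A * m ^ 2 + B * n ^ 2 = C := by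
    obtain ⟨n, rfl⟩ := toZMod_surjective n'
    obtain ⟨α, hα⟩ := (isUnit_of_toZMod_ne_zero hA).exists_left_inv
    have hα' := congrArg PadicInt.toZMod hα
    rw [map_mul, map_one] at hα'
    have key : PadicInt.toZMod (α * (C - B * n ^ 2)) = m' * m' := by
      simp only [map_mul, map_sub, map_pow]
      linear_combination -PadicInt.toZMod α * h + m' * m' * hα'
    obtain ⟨m, hm⟩ := exists_sq_eq_of_toZMod hp (a := α * (C - B * n ^ 2))
      (by rw [key]; exact mul_ne_zero hm hm) ⟨m', key⟩
    refine ⟨m, n, ?_⟩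
    rw [hm]
    linear_combination (C - B * n ^ 2) * hα
  obtain ⟨m', n', h⟩ := exists_conic_point_zmod hp hA hB (PadicInt.toZMod C)
  by_cases hm : m' = 0
  · have hn : n' ≠ 0 := by
      rintro rfl
      rw [hm] at h
      exact hC (by rw [← h]; ring)
    obtain ⟨n, m, h'⟩ := lift (m' := n') (n' := m') hB ((add_comm _ _).trans h) hn
    exact ⟨m, n, (add_comm _ _).trans h'⟩
  · exact lift hA h hm

end Padic

/-- If `X ≡ 2` modulo `3`, then `n² - X r²` has the norm of a square. -/
theorem norm_sq_sub_mul_sq {X : ℤ_[3]} (hX : PadicInt.toZMod X = 2) (n r : ℚ_[3]) :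
    ‖n ^ 2 - X * r ^ 2‖ = max ‖n‖ ‖r‖ ^ 2 := by
  rcases le_or_gt ‖r‖ ‖n‖ with h | h
  · rw [max_eq_left h]
    by_cases hn : n = 0
    · have : r = 0 := by simpa [hn] using h
      simp [hn, this]
    obtain ⟨b, hb⟩ : ∃ b : ℤ_[3], (b : ℚ_[3]) = r / n := ⟨⟨r / n, by
      rw [norm_div]
      exact div_le_one_of_le₀ h (norm_nonneg _)⟩, rfl⟩
    -- 2 is a nonresidue modulo 3, so 1 - 2s² never vanishes there.
    have h1 : ‖((1 - X * b ^ 2 : ℤ_[3]) : ℚ_[3])‖ = 1 := norm_eq_one_of_toZMod_ne_zero (by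
      rw [map_sub, map_mul, map_pow, map_one, hX]
      generalize PadicInt.toZMod b = s
      revert s
      decide)
    have : n ^ 2 - X * r ^ 2 = n ^ 2 * ((1 - X * b ^ 2 : ℤ_[3]) : ℚ_[3]) := by
      push_cast
      rw [hb]
      field_simp
    rw [this, norm_mul, h1, norm_pow, mul_one]
  · rw [max_eq_right h.le]
    have hr : r ≠ 0 := norm_pos_iff.1 ((norm_nonneg n).trans_lt h)
    obtain ⟨b, hb⟩ : ∃ b : ℤ_[3], (b : ℚ_[3]) = n / r := ⟨⟨n / r, by
      rw [norm_div]
      exact div_le_one_of_le₀ h.le (norm_nonneg _)⟩, rfl⟩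
    have hlt : PadicInt.toZMod b = 0 := by
      rw [toZMod_eq_zero_iff, PadicInt.norm_def, hb, norm_div]
      exact (div_lt_one (norm_pos_iff.2 hr)).2 h
    have h1 : ‖((b ^ 2 - X : ℤ_[3]) : ℚ_[3])‖ = 1 :=
      norm_eq_one_of_toZMod_ne_zero (by
        rw [map_sub, map_pow, hlt, hX]
        decide)
    have : n ^ 2 - X * r ^ 2 = r ^ 2 * ((b ^ 2 - X : ℤ_[3]) : ℚ_[3]) := by
      push_cast
      rw [hb]
      field_simp
    rw [this, norm_mul, h1, norm_pow, mul_one]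

/-- Parity of valuations: n² - Xr² has even valuation unless n = r = 0, and 6 has valuation one. -/
theorem anisotropic_three {X : ℤ_[3]} (hX : PadicInt.toZMod X = 2) {m n r : ℚ_[3]}
    (h : m ^ 2 = 6 * (n ^ 2 - X * r ^ 2)) : n = 0 ∧ r = 0 := by
  have h6 : ‖(6 : ℚ_[3])‖ = 3⁻¹ := by
    have h2 : ‖(2 : ℤ_[3])‖ = 1 := norm_eq_one_of_toZMod_ne_zero (by rw [map_ofNat]; decide)
    have h2' : ‖(2 : ℚ_[3])‖ = 1 := by exact_mod_cast h2
    have h3 : ‖(3 : ℚ_[3])‖ = 3⁻¹ := by exact_mod_cast Padic.norm_p (p := 3)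
    rw [show (6 : ℚ_[3]) = 2 * 3 by norm_num, norm_mul, h2', h3, one_mul]
  have hnorm := congrArg norm h
  rw [norm_mul, h6, norm_pow, norm_sq_sub_mul_sq hX] at hnorm
  by_contra hnr
  have hpos : ∃ s : ℚ_[3], s ≠ 0 ∧ ‖m‖ ^ 2 = 3⁻¹ * ‖s‖ ^ 2 := by
    rcases le_total ‖r‖ ‖n‖ with hle | hle
    · refine ⟨n, ?_, by rw [hnorm, max_eq_left hle]⟩
      rintro rfl
      exact hnr ⟨rfl, by simpa using hle⟩
    · refine ⟨r, ?_, by rw [hnorm, max_eq_right hle]⟩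
      rintro rfl
      exact hnr ⟨by simpa using hle, rfl⟩
  obtain ⟨s, hs, hms⟩ := hpos
  have hm : m ≠ 0 := by
    rintro rfl
    rw [norm_zero] at hms
    have := norm_pos_iff.2 hs
    nlinarith
  rw [Padic.norm_eq_zpow_neg_valuation hs, Padic.norm_eq_zpow_neg_valuation hm] at hms
  have : ((3 : ℕ) : ℝ) ^ (2 * -m.valuation) = ((3 : ℕ) : ℝ) ^ (-1 + 2 * -s.valuation) := by
    rw [zpow_add₀ (by norm_num), zpow_mul', zpow_mul']
    simpa using hms
  have := zpow_right_injective₀ (by norm_num) (by norm_num) this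
  omega

/-! ### The quadratic character of `6` -/

/-- Both 2 and 3 are squares: p ≡ ±1 modulo 8 for 2, and quadratic reciprocity for 3. -/
theorem isSquare_six_of_modEq {p : ℕ} [Fact p.Prime]
    (h : (p : ℤ) ≡ 1 [ZMOD 24] ∨ (p : ℤ) ≡ -1 [ZMOD 24]) : IsSquare (6 : ZMod p) := by
  have hmod : p % 24 = 1 ∨ p % 24 = 23 := by
    rcases h with h | h <;> rw [Int.ModEq] at h <;> omega
  have h2 : IsSquare (2 : ZMod p) := (ZMod.exists_sq_eq_two_iff (by omega)).2 (by omega)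
  have h3 : IsSquare ((3 : ℕ) : ZMod p) := by
    rcases hmod with hmod | hmod
    · rw [ZMod.exists_sq_eq_prime_iff_of_mod_four_eq_one (by omega) (by norm_num),
        show (p : ZMod 3) = ((1 : ℕ) : ZMod 3) from
          (ZMod.natCast_eq_natCast_iff' _ _ _).2 (by omega)]
      exact ⟨1, by simp⟩
    · rw [ZMod.exists_sq_eq_prime_iff_of_mod_four_eq_three (by omega) (by norm_num) (by omega),
        show (p : ZMod 3) = ((2 : ℕ) : ZMod 3) from
          (ZMod.natCast_eq_natCast_iff' _ _ _).2 (by omega)]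
      decide
  have := h2.mul h3
  norm_num at this
  exact this

/-- (2/X) = 1 because X ≡ 1 modulo 8, and (3/X) = (X/3) = (2/3) = -1 by reciprocity. -/
theorem jacobiSym_six_eq_neg_one {X : ℕ} (h8 : X % 8 = 1) (h3 : X % 3 = 2) :
    jacobiSym 6 X = -1 := by
  have hodd : Odd X := Nat.odd_iff.2 (by omega)
  rw [show (6 : ℤ) = 2 * 3 by norm_num, jacobiSym.mul_left, jacobiSym.at_two hodd,
    show (3 : ℤ) = ((3 : ℕ) : ℤ) by norm_num,
    jacobiSym.quadratic_reciprocity_one_mod_four' (a := 3) (b := X) (by decide) (by omega), jacobiSym.mod_left,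
    ZMod.χ₈_nat_eq_if_mod_eight, h8]
  rw [show ((X : ℤ) % (3 : ℕ)) = 2 by omega]
  norm_num [show X % 2 = 1 by omega]

/-! ### Points of the surfaces and the Azumaya algebras -/

theorem aeval_poly_iff {k : ℤ} {S : Type} [CommRing S] (P : Fin 3 → S) :
    MvPolynomial.aeval P (poly k) = 0 ↔
      P 0 ^ 2 + P 1 ^ 2 + P 2 ^ 2 + 4 * (P 0 ^ 2 * P 1 ^ 2 + P 1 ^ 2 * P 2 ^ 2 + P 2 ^ 2 * P 0 ^ 2)
        - 16 * (P 0 ^ 2 * P 1 ^ 2 * P 2 ^ 2) = k := by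
  rw [← sub_eq_zero (b := (k : S))]
  simp only [poly, map_add, map_sub, map_mul, map_pow, MvPolynomial.aeval_X, map_ofNat,
    eq_intCast, map_intCast]

theorem Points.equation {k : ℤ} {S : Type} [CommRing S] (P : Points k S) (i : Fin 3) :
    P.1 i ^ 2 + P.1 (i + 1) ^ 2 + P.1 (i + 2) ^ 2
      + 4 * (P.1 i ^ 2 * P.1 (i + 1) ^ 2 + P.1 (i + 1) ^ 2 * P.1 (i + 2) ^ 2
        + P.1 (i + 2) ^ 2 * P.1 i ^ 2)
      - 16 * (P.1 i ^ 2 * P.1 (i + 1) ^ 2 * P.1 (i + 2) ^ 2) = k := by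
  have h := (aeval_poly_iff P.1).1 P.2
  fin_cases i
  · exact h
  · change P.1 1 ^ 2 + P.1 2 ^ 2 + P.1 0 ^ 2 + 4 * (P.1 1 ^ 2 * P.1 2 ^ 2 + P.1 2 ^ 2 * P.1 0 ^ 2
      + P.1 0 ^ 2 * P.1 1 ^ 2) - 16 * (P.1 1 ^ 2 * P.1 2 ^ 2 * P.1 0 ^ 2) = k
    linear_combination h
  · change P.1 2 ^ 2 + P.1 0 ^ 2 + P.1 1 ^ 2 + 4 * (P.1 2 ^ 2 * P.1 0 ^ 2 + P.1 0 ^ 2 * P.1 1 ^ 2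
      + P.1 1 ^ 2 * P.1 2 ^ 2) - 16 * (P.1 2 ^ 2 * P.1 0 ^ 2 * P.1 1 ^ 2) = k
    linear_combination h

/-- The function `4 xᵢ² + 1` at a point. -/
def Points.factor {k : ℤ} {S : Type} [CommRing S] (P : Points k S) (i : Fin 3) : S :=
  4 * P.1 i ^ 2 + 1

/-- The function `16 xyz` at a point. -/
def Points.cross {k : ℤ} {S : Type} [CommRing S] (P : Points k S) (i : Fin 3) : S :=
  16 * (P.1 i * P.1 (i + 1) * P.1 (i + 2))

/-- The function `2 (4 xⱼ² + 1) (4 xₗ² + 1)` at a point, for `{i, j, l} = {0, 1, 2}`. -/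
def Points.cofactor {k : ℤ} {S : Type} [CommRing S] (P : Points k S) (i : Fin 3) : S :=
  2 * (P.factor (i + 1) * P.factor (i + 2))

/-- The key identity: the product of the three factors differs from a square by a constant on the
surface. It extends the algebra over the zeros of the factor and controls the primes dividing the
factor. -/
theorem Points.cross_sq_sub {k : ℤ} {S : Type} [CommRing S] (P : Points k S) (i : Fin 3) :
    P.cross i ^ 2 - P.factor i * P.cofactor i = -2 * (4 * (k : S) + 1) := by
  rw [cross, cofactor, factor, factor, factor, ← P.equation i]
  ring

theorem Points.map_factor {k : ℤ} {S T : Type} [CommRing S] [CommRing T] (g : S →+* T)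
    (P : Points k S) (i : Fin 3) : (P.map g).factor i = g (P.factor i) := by
  simp [factor, map, map_ofNat]

theorem Points.map_cross {k : ℤ} {S T : Type} [CommRing S] [CommRing T] (g : S →+* T)
    (P : Points k S) (i : Fin 3) : (P.map g).cross i = g (P.cross i) := by
  simp [cross, map, map_ofNat]

theorem Points.map_cofactor {k : ℤ} {S T : Type} [CommRing S] [CommRing T] (g : S →+* T)
    (P : Points k S) (i : Fin 3) : (P.map g).cofactor i = g (P.cofactor i) := by
  simp [cofactor, map_factor, map_ofNat]

/-- The universal point. -/
noncomputable def universalPoint (k : ℤ) : Points k (CoordRing k) :=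
  ⟨coord k, by
    have h (p : MvPolynomial (Fin 3) ℤ) : MvPolynomial.aeval (coord k) p =
        Ideal.Quotient.mk _ (MvPolynomial.map (Int.castRingHom ℚ) p) := by
      induction p using MvPolynomial.induction_on with
      | C a => rw [MvPolynomial.aeval_C, MvPolynomial.map_C]; simp
      | add p q hp hq => rw [map_add, map_add, map_add, hp, hq]
      | mul_X p i hp => rw [map_mul, map_mul, map_mul, hp, MvPolynomial.aeval_X,
          MvPolynomial.map_X]; rfl
    exact (h _).trans (Ideal.Quotient.eq_zero_iff_mem.2 (Ideal.mem_span_singleton_self _))⟩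

theorem map_evalHom_universalPoint {k : ℤ} {L : Type} [Field L] [Algebra ℚ L] (P : Points k L) :
    (universalPoint k).map (evalHom P) = P :=
  Subtype.ext (funext fun i => by
    change evalHom P (coord k i) = P.1 i
    simp [evalHom, coord])

theorem four_mul_add_one_ne_zero (k : ℤ) : 4 * (k : ℚ) + 1 ≠ 0 := by
  have : 4 * k + 1 ≠ 0 := by omega
  exact_mod_cast this

theorem isUnit_ratCast {R : Type} [CommRing R] [Algebra ℚ R] {q : ℚ} (hq : q ≠ 0) :
    IsUnit (algebraMap ℚ R q) := (Ne.isUnit hq).map _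

theorem isUnit_two {R : Type} [CommRing R] [Algebra ℚ R] : IsUnit (2 : R) := by
  rw [← map_ofNat (algebraMap ℚ R) 2]
  exact isUnit_ratCast (by norm_num)

theorem Points.isUnit_discriminant {k : ℤ} {R : Type} [CommRing R] [Algebra ℚ R]
    (P : Points k R) (i : Fin 3) :
    IsUnit ((2 * P.cross i) ^ 2 - 4 * (P.factor i * P.cofactor i)) := by
  have h : (2 * P.cross i) ^ 2 - 4 * (P.factor i * P.cofactor i) =
      algebraMap ℚ R (-8 * (4 * (k : ℚ) + 1)) := by
    simp only [map_mul, map_add, map_neg, map_ofNat, map_one, map_intCast]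
    linear_combination 4 * P.cross_sq_sub i
  rw [h]
  exact isUnit_ratCast (mul_ne_zero (by norm_num) (four_mul_add_one_ne_zero k))

/-- The quaternion algebra `(4 xᵢ² + 1, -2 (4k + 1))`, extended to an Azumaya algebra on the
whole surface. -/
noncomputable def surfaceAlgebra (k : ℤ) (i : Fin 3) : AzumayaAlgebra (CoordRing k) where
  carrier := BinaryClifford (CoordRing k) ((universalPoint k).factor i)
    (2 * (universalPoint k).cross i) ((universalPoint k).cofactor i)
  isAzumaya := BinaryClifford.isAzumaya ((universalPoint k).isUnit_discriminant i)

/-- The base change of `surfaceAlgebra k i` along a `T`-point. -/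
noncomputable def surfaceAlgebraBaseChange (k : ℤ) (i : Fin 3) (T : Type) [CommRing T]
    [Algebra (CoordRing k) T] (P : Points k T)
    (hP : (universalPoint k).map (algebraMap (CoordRing k) T) = P) :
    T ⊗[CoordRing k] (surfaceAlgebra k i).carrier ≃ₐ[T]
      BinaryClifford T (P.factor i) (2 * P.cross i) (P.cofactor i) :=
  BinaryClifford.baseChange T (by rw [← hP, Points.map_factor])
    (by rw [← hP, Points.map_cross, map_mul, map_ofNat]) (by rw [← hP, Points.map_cofactor])

theorem isSplitAt_surfaceAlgebra_iff {k : ℤ} {L : Type} [Field L] [Algebra ℚ L] (P : Points k L)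
    (i : Fin 3) : IsSplitAt (surfaceAlgebra k i) (evalHom P) ↔
      IsSplit L (BinaryClifford L (P.factor i) (2 * P.cross i) (P.cofactor i)) := by
  let _ : Algebra (CoordRing k) L := (evalHom P).toAlgebra
  let e := surfaceAlgebraBaseChange k i L P (map_evalHom_universalPoint P)
  exact ⟨IsSplit.of_algEquiv e, IsSplit.of_algEquiv e.symm⟩

theorem Points.isSplit {k : ℤ} {T : Type} [CommRing T] [Algebra ℚ T] (P : Points k T) (i : Fin 3)
    (r q : T) (h : P.factor i * r ^ 2 + -2 * (4 * (k : T) + 1) * q ^ 2 = 1) :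
    IsSplit T (BinaryClifford T (P.factor i) (2 * P.cross i) (P.cofactor i)) := by
  refine BinaryClifford.isSplit_of_represents_one (P.isUnit_discriminant i) isUnit_two r 0 q ?_
  rw [P.cross_sq_sub i]
  linear_combination h

theorem localInv_eq_zero {k : ℤ} {L : Type} [Field L] [Algebra ℚ L] (P : Points k L) (i : Fin 3)
    (r q : L) (h : P.factor i * r ^ 2 + -2 * (4 * (k : L) + 1) * q ^ 2 = 1) :
    localInv (surfaceAlgebra k i) (evalHom P) = 0 := by
  rw [localInv, if_pos]
  exact (isSplitAt_surfaceAlgebra_iff P i).2 (P.isSplit i r q h)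

theorem exists_mul_sq_eq_one {T : Type} [CommRing T] [Algebra ℚ T]
    (ι : AlgebraicClosure ℚ →ₐ[ℚ] T) (k : ℤ) : ∃ q : T, -2 * (4 * (k : T) + 1) * q ^ 2 = 1 := by
  obtain ⟨s, hs⟩ := IsAlgClosed.exists_pow_nat_eq
    (algebraMap ℚ (AlgebraicClosure ℚ) (-2 * (4 * (k : ℚ) + 1))⁻¹) (n := 2) (by norm_num)
  refine ⟨ι s, ?_⟩
  have h1 : -2 * (4 * (k : T) + 1) = algebraMap ℚ T (-2 * (4 * (k : ℚ) + 1)) := by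
    simp only [map_mul, map_add, map_neg, map_ofNat, map_one, map_intCast]
  rw [← map_pow, hs, AlgHom.commutes, h1, ← map_mul,
    mul_inv_cancel₀ (mul_ne_zero (by norm_num) (four_mul_add_one_ne_zero k)), map_one]

theorem isAlgebraicClass_surfaceAlgebra (k : ℤ) (i : Fin 3) :
    IsAlgebraicClass (surfaceAlgebra k i) := by
  refine IsSplit.of_algEquiv (surfaceAlgebraBaseChange k i _ _ rfl).symm ?_
  obtain ⟨q, hq⟩ := exists_mul_sq_eq_one (T := CoordRing k ⊗[ℚ] AlgebraicClosure ℚ)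
    Algebra.TensorProduct.includeRight k
  exact Points.isSplit _ i 0 q (by rw [hq]; ring)

/-! ### The class over the function field -/

theorem prime_four_mul_X_sq_add_one (i : Fin 3) :
    Prime (4 * MvPolynomial.X i ^ 2 + 1 : MvPolynomial (Fin 3) ℚ) := by
  have hirr : Irreducible (Polynomial.C 4 * Polynomial.X ^ 2 + Polynomial.C 0 * Polynomial.X +
      Polynomial.C 1 : Polynomial ℚ) := by
    refine Polynomial.irreducible_of_degree_le_three_of_not_isRoot ?_ fun x hx => ?_
    · rw [Polynomial.natDegree_quadratic (by norm_num)]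
      decide
    · simp at hx
      nlinarith [sq_nonneg x]
  let s : Set (Fin 3) := {i}
  have h2 := (MulEquiv.prime_iff (MvPolynomial.uniqueAlgEquiv ℚ s).symm).2 hirr.prime
  have h3 := (MvPolynomial.prime_rename_iff s).2 h2
  convert h3 using 1
  simp only [map_add, map_mul, map_pow, MvPolynomial.uniqueAlgEquiv_symm_apply,
    Polynomial.eval₂_X, MvPolynomial.rename_X, map_ofNat, map_zero, map_one, zero_mul, add_zero]
  rfl

/-- The prime 4xᵢ² + 1 does not divide the surface polynomial F, since F takes the value -(4k+1)/4 ≠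
0 at xᵢ = √-1/2 with the other coordinates zero. Hence in gq = hF, with q this prime, q divides h
and cancels. Irreducibility of F is not needed. -/
theorem factor_mem_nonZeroDivisors (k : ℤ) (i : Fin 3) :
    (universalPoint k).factor i ∈ nonZeroDivisors (CoordRing k) := by
  rw [mem_nonZeroDivisors_iff_right]
  intro r hr
  obtain ⟨g, rfl⟩ := Ideal.Quotient.mk_surjective r
  set F := MvPolynomial.map (Int.castRingHom ℚ) (poly k)
  have hprime := prime_four_mul_X_sq_add_one i
  have hmem : g * (4 * MvPolynomial.X i ^ 2 + 1) ∈ Ideal.span {F} := by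
    rw [← Ideal.Quotient.eq_zero_iff_mem]
    rw [map_mul, map_add, map_mul, map_ofNat, map_pow, map_one]
    exact hr
  obtain ⟨h, hh⟩ := Ideal.mem_span_singleton'.1 hmem
  have hF : ¬ (4 * MvPolynomial.X i ^ 2 + 1) ∣ F := by
    rintro ⟨G, hG⟩
    let v : Fin 3 → ℂ := Pi.single i (Complex.I / 2)
    have := congrArg (MvPolynomial.aeval v) hG
    have hv : v i ^ 2 = -(1 / 4) := by
      simp [v, div_pow]
      norm_num
    rw [map_mul, map_add, map_mul, map_pow, MvPolynomial.aeval_X, hv] at this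
    have hz : (MvPolynomial.aeval v) (4 : MvPolynomial (Fin 3) ℚ) * (-(1 / 4)) +
      (MvPolynomial.aeval v) (1 : MvPolynomial (Fin 3) ℚ) = 0 := by
      simp only [map_ofNat, map_one]
      norm_num
    rw [hz, zero_mul] at this
    have h4 : ((4 * k + 1 : ℤ) : ℂ) = 0 := by
      have h5 : v 0 ^ 2 + v 1 ^ 2 + v 2 ^ 2 + 4 * (v 0 ^ 2 * v 1 ^ 2 + v 1 ^ 2 * v 2 ^ 2 +
          v 2 ^ 2 * v 0 ^ 2) - 16 * (v 0 ^ 2 * v 1 ^ 2 * v 2 ^ 2) - k = 0 := by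
        simpa [F, poly] using this
      push_cast
      fin_cases i <;> simp [v, div_pow] at h5 <;> linear_combination -4 * h5
    have : 4 * k + 1 = 0 := by exact_mod_cast h4
    omega
  obtain ⟨h', rfl⟩ := (hprime.dvd_or_dvd (Dvd.intro_left g hh.symm)).resolve_right hF
  rw [Ideal.Quotient.eq_zero_iff_mem, Ideal.mem_span_singleton']
  refine ⟨h', mul_left_cancel₀ hprime.ne_zero ?_⟩
  linear_combination hh

theorem hasGenericClass_surfaceAlgebra (k : ℤ) (i : Fin 3) :
    HasGenericClass (surfaceAlgebra k i) (4 * coord k i ^ 2 + 1)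
      (-2 * (4 * (k : CoordRing k) + 1)) := by
  let K := FractionRing (CoordRing k)
  let φ := algebraMap (CoordRing k) K
  let e : K ⊗[CoordRing k] (surfaceAlgebra k i).carrier ≃ₐ[K]
      BinaryClifford K (φ ((universalPoint k).factor i)) (2 * φ ((universalPoint k).cross i))
        (φ ((universalPoint k).cofactor i)) :=
    BinaryClifford.baseChange K rfl (by rw [map_mul, map_ofNat]) rfl
  obtain ⟨α, hα⟩ := (IsLocalization.map_units K
    ⟨_, factor_mem_nonZeroDivisors k i⟩).exists_left_inv
  let e' : QuaternionAlgebra K (φ ((universalPoint k).factor i)) 0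
      (φ (-2 * (4 * (k : CoordRing k) + 1))) ≃ₐ[K] _ :=
    BinaryClifford.quaternionEquiv hα (by
      rw [← (universalPoint k).cross_sq_sub i, map_sub, map_mul, map_pow])
  exact ⟨K, K, inferInstance, inferInstance, inferInstance, inferInstance, inferInstance,
    inferInstance, inferInstance, inferInstance, inferInstance, inferInstance,
    ⟨Algebra.TensorProduct.congr (e.trans e'.symm) AlgEquiv.refl⟩⟩

/-! ### Local analysis -/

/-- The point with coordinates `x, y, z`. -/
def Points.mk {k : ℤ} {S : Type} [CommRing S] (x y z : S)
    (h : x ^ 2 + y ^ 2 + z ^ 2 + 4 * (x ^ 2 * y ^ 2 + y ^ 2 * z ^ 2 + z ^ 2 * x ^ 2)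
      - 16 * (x ^ 2 * y ^ 2 * z ^ 2) = k) : Points k S :=
  ⟨![x, y, z], (aeval_poly_iff _).2 h⟩

theorem factor_eq_two {k : ℤ} (hk : k % 3 = 2) (P : Points k (ZMod 3)) (i : Fin 3) :
    P.factor i = 2 := by
  have key : ∀ x y z : ZMod 3, x ^ 2 + y ^ 2 + z ^ 2 +
      4 * (x ^ 2 * y ^ 2 + y ^ 2 * z ^ 2 + z ^ 2 * x ^ 2) - 16 * (x ^ 2 * y ^ 2 * z ^ 2) = 2 →
      4 * x ^ 2 + 1 = 2 := by decide
  have hk' : (k : ZMod 3) = 2 := by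
    have := (ZMod.intCast_eq_intCast_iff' k 2 3).2 (by omega)
    simpa using this
  exact key _ _ _ ((P.equation i).trans hk')

/-- If x and y are both odd, the equation modulo 4 reads 2 + z² = 1, which is impossible. Evenness
is phrased as 2x = 0 in ℤ/4 so that it can be pulled back to both ℤ and ℤ₂. -/
theorem two_mul_eq_zero_or {k : ℤ} (hk : k % 4 = 1) (P : Points k (ZMod 4)) :
    2 * P.1 0 = 0 ∨ 2 * P.1 1 = 0 := by
  have key : ∀ x y z : ZMod 4, x ^ 2 + y ^ 2 + z ^ 2 +
      4 * (x ^ 2 * y ^ 2 + y ^ 2 * z ^ 2 + z ^ 2 * x ^ 2) - 16 * (x ^ 2 * y ^ 2 * z ^ 2) = 1 →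
      2 * x = 0 ∨ 2 * y = 0 := by decide
  have hk' : (k : ZMod 4) = 1 := by
    have := (ZMod.intCast_eq_intCast_iff' k 1 4).2 (by omega)
    simpa using this
  exact key _ _ _ ((P.equation 0).trans hk')

/-- At a zero of the factor, the key identity reads (16xyz)² = 6(3ℓ)²; divide by 3ℓ unless p divides
ℓ. -/
theorem isSquare_six_of_factor_eq_zero {k ℓ : ℤ} (hk : 4 * k + 1 = -27 * ℓ ^ 2)
    (hprime : ∀ p : ℕ, p.Prime → (p : ℤ) ∣ ℓ → (p : ℤ) ≡ 1 [ZMOD 24] ∨ (p : ℤ) ≡ -1 [ZMOD 24])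
    {p : ℕ} [Fact p.Prime] (hp : p ≠ 3) (P : Points k (ZMod p)) (i : Fin 3)
    (h : P.factor i = 0) : IsSquare (6 : ZMod p) := by
  by_cases hℓ : (ℓ : ZMod p) = 0
  · exact isSquare_six_of_modEq (hprime p Fact.out ((ZMod.intCast_zmod_eq_zero_iff_dvd _ _).1 hℓ))
  · have h3 : (3 : ZMod p) ≠ 0 := by
      intro h
      have h3 : ((3 : ℕ) : ZMod p) = 0 := by exact_mod_cast h
      rw [ZMod.natCast_eq_zero_iff] at h3
      exact hp ((Nat.prime_dvd_prime_iff_eq Fact.out Nat.prime_three).1 h3)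
    have hk' : (4 * k + 1 : ZMod p) = -27 * ℓ ^ 2 := by exact_mod_cast congrArg (Int.cast) hk
    have hc := P.cross_sq_sub i
    rw [h, hk'] at hc
    refine ⟨P.cross i / (3 * ℓ), ?_⟩
    field_simp
    linear_combination -hc

/-- Let X = 4xᵢ² + 1 with xᵢ even. Then (6/X) = -1, so some prime q dividing X has 6 as a
nonresidue, yet 6 is a square modulo every prime other than 3 dividing X. -/
theorem isEmpty_points_int {k ℓ : ℤ} (hk : 4 * k + 1 = -27 * ℓ ^ 2) (h4 : k % 4 = 1)
    (h3 : k % 3 = 2)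
    (hprime : ∀ p : ℕ, p.Prime → (p : ℤ) ∣ ℓ → (p : ℤ) ≡ 1 [ZMOD 24] ∨ (p : ℤ) ≡ -1 [ZMOD 24]) :
    IsEmpty (Points k ℤ) := by
  refine ⟨fun P => ?_⟩
  obtain ⟨i, hi⟩ : ∃ i, 2 ∣ P.1 i := by
    have even (i) (h : 2 * (P.map (Int.castRingHom (ZMod 4))).1 i = 0) : 2 ∣ P.1 i := by
      have h' : ((2 * P.1 i : ℤ) : ZMod 4) = 0 := by
        rw [Int.cast_mul]
        exact h
      have := (ZMod.intCast_zmod_eq_zero_iff_dvd _ 4).1 h'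
      omega
    exact (two_mul_eq_zero_or h4 (P.map (Int.castRingHom _))).elim
      (fun h => ⟨0, even 0 h⟩) (fun h => ⟨1, even 1 h⟩)
  obtain ⟨X, hX⟩ : ∃ X : ℕ, (X : ℤ) = P.factor i :=
    ⟨(P.factor i).toNat, Int.toNat_of_nonneg (by rw [Points.factor]; positivity)⟩
  have hX8 : X % 8 = 1 := by
    obtain ⟨m, hm⟩ := hi
    rw [Points.factor, hm] at hX
    have : (X : ℤ) = 8 * (2 * m ^ 2) + 1 := by rw [hX]; ring
    omega
  have hX3 : X % 3 = 2 := by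
    have h := factor_eq_two h3 (P.map (Int.castRingHom _)) i
    rw [Points.map_factor, ← hX] at h
    have h' : ((X : ℕ) : ZMod 3) = ((2 : ℕ) : ZMod 3) := by simpa using h
    exact (ZMod.natCast_eq_natCast_iff' _ _ _).1 h'
  obtain ⟨q, hq, hqX, hJ⟩ :=
    jacobiSym.eq_neg_one_at_prime_divisor_of_eq_neg_one (jacobiSym_six_eq_neg_one hX8 hX3)
  have : Fact q.Prime := ⟨hq⟩
  refine ZMod.nonsquare_of_jacobiSym_eq_neg_one hJ ?_
  have hzero : (P.map (Int.castRingHom (ZMod q))).factor i = 0 := by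
    rw [Points.map_factor, ← hX]
    simpa using (ZMod.natCast_eq_zero_iff X q).2 hqX
  have := isSquare_six_of_factor_eq_zero hk hprime (by rintro rfl; omega) _ i hzero
  exact_mod_cast this

/-! ### Local solubility -/

theorem nonempty_points_two {k : ℤ} (hk : k % 4 = 1) : Nonempty (Points k ℤ_[2]) := by
  have h8 : k % 8 = 1 ∨ k % 8 = 5 := by omega
  rcases h8 with h8 | h8
  · obtain ⟨b, rfl⟩ : ∃ b, k = 1 + 8 * b := ⟨k / 8, by omega⟩
    obtain ⟨z, hz⟩ := exists_sq_eq_of_two_adic b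
    exact ⟨.mk 0 0 z (by push_cast; linear_combination hz)⟩
  · obtain ⟨b, rfl⟩ : ∃ b, k = 5 + 8 * b := ⟨k / 8, by omega⟩
    have h17 : PadicInt.toZMod (17 : ℤ_[2]) ≠ 0 := by
      rw [map_ofNat]
      decide
    obtain ⟨u, hu⟩ := (isUnit_of_toZMod_ne_zero h17).exists_left_inv
    obtain ⟨z, hz⟩ := exists_sq_eq_of_two_adic (u * (b - 2))
    -- At (2, 0, z) the equation is 17z² = k - 4 = 1 + 8b, and 17 is a unit with inverse `u`.
    exact ⟨.mk 2 0 z (by push_cast; linear_combination 17 * hz + 8 * (b - 2) * hu)⟩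

/-- Setting y = 1/2 cancels the x²z² terms and leaves the conic x² + z² = (4k-1)/8, solvable when
the right side is a unit. Otherwise k ≡ (1/2)² modulo p, and (√k, 0, 0) is a point. In the proof `h`
is 1/2. -/
theorem nonempty_points_odd (k : ℤ) {p : ℕ} [Fact p.Prime] (hp : p ≠ 2) :
    Nonempty (Points k ℤ_[p]) := by
  have h2 := two_ne_zero_zmod hp
  obtain ⟨h, hh⟩ := (isUnit_of_toZMod_ne_zero (p := p) (x := 2)
    (by rw [map_ofNat]; exact h2)).exists_left_inv
  have hh' : PadicInt.toZMod h * 2 = 1 := by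
    have := congrArg PadicInt.toZMod hh
    rwa [map_mul, map_one, map_ofNat] at this
  have hne : PadicInt.toZMod h ≠ 0 := left_ne_zero_of_mul_eq_one hh'
  by_cases hk : 4 * (k : ZMod p) - 1 = 0
  · have hk' : (k : ZMod p) = PadicInt.toZMod h * PadicInt.toZMod h := by
      linear_combination PadicInt.toZMod h ^ 2 * hk - k * (PadicInt.toZMod h * 2 + 1) * hh'
    obtain ⟨x, hx⟩ := exists_sq_eq_of_toZMod hp (a := (k : ℤ_[p]))
      (by rw [map_intCast, hk']; exact mul_ne_zero hne hne) (by rw [map_intCast]; exact ⟨_, hk'⟩)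
    exact ⟨.mk x 0 0 (by linear_combination hx)⟩
  · have hc : PadicInt.toZMod ((4 * (k : ℤ_[p]) - 1) * h ^ 3) ≠ 0 := by
      simp only [map_mul, map_sub, map_pow, map_intCast, map_one, map_ofNat]
      exact mul_ne_zero hk (pow_ne_zero 3 hne)
    have h1 : PadicInt.toZMod (1 : ℤ_[p]) ≠ 0 := by
      rw [map_one]
      exact one_ne_zero
    obtain ⟨x, z, hxz⟩ := exists_conic_point hp h1 h1 hc
    have hx : x ^ 2 = (4 * (k : ℤ_[p]) - 1) * h ^ 3 - z ^ 2 := by linear_combination hxz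
    have hh2 : h ^ 2 * 4 = 1 := by linear_combination (h * 2 + 1) * hh
    refine ⟨.mk x h z ?_⟩
    have h3 : 2 * h ^ 3 = h ^ 2 := by linear_combination h ^ 2 * hh
    have h4 : h ^ 2 * (4 * (k : ℤ_[p])) = k := by linear_combination k * hh2
    linear_combination (1 + x ^ 2 + z ^ 2 - 4 * z ^ 2 * x ^ 2 - 1) * hh2 + 2 * hxz +
      (4 * (k : ℤ_[p]) - 1) * h3 + h4

theorem nonempty_points_real {k : ℤ} (hk : k ≤ 6) : Nonempty (Points k ℝ) := by
  have hk' : (k : ℝ) ≤ 6 := by exact_mod_cast hk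
  have hz : √((6 - k : ℝ) / 7) ^ 2 = (6 - k) / 7 := Real.sq_sqrt (by linarith)
  -- At (1, 1, z) the equation is 6 - 7z² = k.
  exact ⟨.mk 1 1 (√((6 - k) / 7)) (by rw [hz]; ring)⟩

/-! ### Local invariants -/

theorem invInf_surfaceAlgebra {k : ℤ} (P : AdelicPoints k) (i : Fin 3) :
    invInf (surfaceAlgebra k i) P = 0 := by
  have hpos : 0 < P.inf.factor i := by
    rw [Points.factor]
    positivity
  refine localInv_eq_zero _ i (√(P.inf.factor i))⁻¹ 0 ?_
  rw [inv_pow, Real.sq_sqrt hpos.le, mul_inv_cancel₀ hpos.ne']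
  ring

section Padic

variable {p : ℕ} [Fact p.Prime] {k : ℤ} (P : Points k ℤ_[p]) (i : Fin 3)

theorem localInv_padic_eq_zero (r q : ℚ_[p]) {ℓ : ℤ} (hℓ : ℓ ≠ 0)
    (hk : 4 * k + 1 = -27 * ℓ ^ 2) (h : (P.factor i : ℚ_[p]) * r ^ 2 + 6 * q ^ 2 = 1) :
    localInv (surfaceAlgebra k i) (evalHom (P.map (PadicInt.Coe.ringHom (p := p)))) = 0 := by
  -- -2(4k+1) = 6(3ℓ)², so dividing q by 3ℓ replaces this constant by 6.
  refine localInv_eq_zero _ i r (q / (3 * ℓ)) ?_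
  rw [Points.map_factor]
  have hk' : (4 * k + 1 : ℚ_[p]) = -27 * ℓ ^ 2 := by exact_mod_cast congrArg (Int.cast) hk
  have hℓ' : (ℓ : ℚ_[p]) ≠ 0 := by exact_mod_cast hℓ
  rw [hk']
  refine Eq.trans ?_ h
  change (P.factor i : ℚ_[p]) * r ^ 2 + _ = _
  field_simp
  ring

/-- If 6 is a square modulo p, it is one in ℤₚ and the class is trivial. If not, the factor is a
unit, and the conic Xr² + 6q² = 1 with unit coefficients has a point. -/
theorem localInv_padic_of_five_le (hp : p ≠ 2) (hp' : p ≠ 3) {ℓ : ℤ} (hℓ : ℓ ≠ 0)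
    (hk : 4 * k + 1 = -27 * ℓ ^ 2)
    (hprime : ∀ p : ℕ, p.Prime → (p : ℤ) ∣ ℓ → (p : ℤ) ≡ 1 [ZMOD 24] ∨ (p : ℤ) ≡ -1 [ZMOD 24]) :
    localInv (surfaceAlgebra k i) (evalHom (P.map (PadicInt.Coe.ringHom (p := p)))) = 0 := by
  have h6 : PadicInt.toZMod (6 : ℤ_[p]) ≠ 0 := by
    rw [map_ofNat]
    intro h
    have h6 : ((6 : ℕ) : ZMod p) = 0 := by exact_mod_cast h
    rw [ZMod.natCast_eq_zero_iff, show 6 = 2 * 3 by norm_num,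
      (Fact.out : p.Prime).dvd_mul] at h6
    rcases h6 with h6 | h6
    · exact hp ((Nat.prime_dvd_prime_iff_eq Fact.out Nat.prime_two).1 h6)
    · exact hp' ((Nat.prime_dvd_prime_iff_eq Fact.out Nat.prime_three).1 h6)
  by_cases hsq : IsSquare (6 : ZMod p)
  · obtain ⟨s, hs⟩ := exists_sq_eq_of_toZMod hp h6 (by rwa [map_ofNat])
    have hs' : (s : ℚ_[p]) ^ 2 = 6 := by exact_mod_cast congrArg (fun z : ℤ_[p] => (z : ℚ_[p])) hs
    refine localInv_padic_eq_zero P i 0 (s : ℚ_[p])⁻¹ hℓ hk ?_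
    rw [inv_pow, hs']
    norm_num
  · have hX : PadicInt.toZMod (P.factor i) ≠ 0 := fun h => hsq
      (isSquare_six_of_factor_eq_zero hk hprime hp' (P.map PadicInt.toZMod) i
        (by rw [Points.map_factor, h]))
    obtain ⟨r, q, hrq⟩ := exists_conic_point hp hX h6
      (C := 1) (by rw [map_one]; exact one_ne_zero)
    exact localInv_padic_eq_zero P i r q hℓ hk (by exact_mod_cast congrArg ((↑) : ℤ_[p] → ℚ_[p]) hrq)

end Padic

/-- If xᵢ = 2m, the factor is 1 + 16m², a 2-adic square. -/
theorem localInv_two {k : ℤ} (P : Points k ℤ_[2]) (i : Fin 3) {ℓ : ℤ} (hℓ : ℓ ≠ 0)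
    (hk : 4 * k + 1 = -27 * ℓ ^ 2) (hi : 2 ∣ P.1 i) :
    localInv (surfaceAlgebra k i) (evalHom (P.map (PadicInt.Coe.ringHom (p := 2)))) = 0 := by
  obtain ⟨m, hm⟩ := hi
  obtain ⟨z, hz⟩ := exists_sq_eq_of_two_adic (2 * m ^ 2)
  have hX : P.factor i = z ^ 2 := by
    rw [Points.factor, hm, hz]
    ring
  have hz0 : (z : ℚ_[2]) ≠ 0 := by
    intro h0
    have hz0 : z = 0 := Subtype.ext h0
    rw [hz0] at hz
    have := congrArg PadicInt.toZMod hz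
    simp only [map_add, map_mul, map_pow, map_zero, map_one, map_ofNat] at this
    rw [show (8 : ZMod 2) = 0 by decide] at this
    simp at this
  refine localInv_padic_eq_zero P i (z : ℚ_[2])⁻¹ 0 hℓ hk ?_
  rw [hX]
  push_cast
  field_simp
  ring

theorem exists_two_dvd {k : ℤ} (hk : k % 4 = 1) (P : Points k ℤ_[2]) :
    2 ∣ P.1 0 ∨ 2 ∣ P.1 1 := by
  have even (i) (h : 2 * (P.map (PadicInt.toZModPow 2)).1 i = 0) : 2 ∣ P.1 i := by
    have h' : 2 * P.1 i ∈ RingHom.ker (PadicInt.toZModPow (p := 2) 2) := by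
      rw [RingHom.mem_ker, map_mul, map_ofNat]
      exact h
    rw [PadicInt.ker_toZModPow, Ideal.mem_span_singleton'] at h'
    obtain ⟨b, hb⟩ := h'
    refine ⟨b, mul_left_cancel₀ (two_ne_zero' ℤ_[2]) ?_⟩
    rw [← hb]
    push_cast
    ring
  exact (two_mul_eq_zero_or hk (P.map (PadicInt.toZModPow 2))).imp (even 0) (even 1)

theorem localInv_three {k : ℤ} (P : Points k ℤ_[3]) (i : Fin 3) {ℓ : ℤ} (hℓ : ℓ ≠ 0)
    (hk : 4 * k + 1 = -27 * ℓ ^ 2) (h3 : k % 3 = 2) :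
    localInv (surfaceAlgebra k i) (evalHom (P.map (PadicInt.Coe.ringHom (p := 3)))) =
      ((1 / 2 : ℚ) : AddCircle (1 : ℚ)) := by
  rw [localInv, if_neg]
  rw [isSplitAt_surfaceAlgebra_iff]
  have hX : PadicInt.toZMod (P.factor i) = 2 := by
    rw [← Points.map_factor]
    exact factor_eq_two h3 _ i
  have hℓ' : (3 * ℓ : ℚ_[3]) ≠ 0 := mul_ne_zero (by norm_num) (by exact_mod_cast hℓ)
  have hk' : (4 * k + 1 : ℚ_[3]) = -27 * ℓ ^ 2 := by exact_mod_cast congrArg (Int.cast) hk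
  have hXmap : (P.map (PadicInt.Coe.ringHom (p := 3))).factor i = (P.factor i : ℚ_[3]) :=
    Points.map_factor _ _ _
  refine BinaryClifford.not_isSplit two_ne_zero ?_ (Points.cross_sq_sub _ i) fun m n r h => ?_
  · rw [hXmap]
    intro h0
    have h0' : P.factor i = 0 := Subtype.ext h0
    rw [h0', map_zero] at hX
    exact absurd hX (by decide)
  · rw [hXmap, hk'] at h
    -- Here d = 54ℓ² = 6(3ℓ)²; the square is absorbed into n and r.
    obtain ⟨h1, h2⟩ := anisotropic_three hX (m := m) (n := 3 * ℓ * n) (r := 3 * ℓ * r)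
      (by rw [h]; ring)
    exact ⟨(mul_eq_zero.1 h1).resolve_left hℓ', (mul_eq_zero.1 h2).resolve_left hℓ'⟩

/-! ### The obstruction and the main theorem -/

theorem half_ne_zero : ((1 / 2 : ℚ) : AddCircle (1 : ℚ)) ≠ 0 := by
  intro h
  obtain ⟨n, hn⟩ := AddCircle.coe_eq_zero_iff (1 : ℚ) |>.1 h
  rw [zsmul_one] at hn
  have : 2 * n = 1 := by
    have : (2 * n : ℚ) = 1 := by rw [hn]; norm_num
    exact_mod_cast this
  omega

theorem pairing_ne_zero {k : ℤ} {A : AzumayaAlgebra (CoordRing k)} {P : AdelicPoints k}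
    (hinf : invInf A P = 0) (hfin : ∀ p : Nat.Primes, invFin A P p =
      if (p : ℕ) = 3 then ((1 / 2 : ℚ) : AddCircle (1 : ℚ)) else 0) : pairing A P ≠ 0 := by
  let p₃ : Nat.Primes := ⟨3, Nat.prime_three⟩
  rw [pairing, hinf, zero_add, finsum_eq_single _ p₃, hfin, if_pos rfl]
  · exact half_ne_zero
  · intro p hp
    rw [hfin, if_neg fun h => hp (Subtype.ext h)]

end MK3

theorem mainTheorem1 (k ℓ : ℤ)
    (hk : (k : ℚ) = -(1 / 4) * (1 + 27 * (ℓ : ℚ) ^ 2))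
    (h8 : ℓ ≡ 1 [ZMOD 8] ∨ ℓ ≡ -1 [ZMOD 8])
    (h5 : ℓ ≡ 1 [ZMOD 5])
    (h7 : ℓ ≡ 3 [ZMOD 7])
    (h37 : ¬ ℓ ≡ 10 [ZMOD 37] ∧ ¬ ℓ ≡ -10 [ZMOD 37])
    (hprime : ∀ p : ℕ, p.Prime → (p : ℤ) ∣ ℓ →
      (p : ℤ) ≡ 1 [ZMOD 24] ∨ (p : ℤ) ≡ -1 [ZMOD 24]) :
    ∃ A₁ A₂ : MK3.AzumayaAlgebra (MK3.CoordRing k),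
      MK3.HasGenericClass A₁ (4 * MK3.coord k 0 ^ 2 + 1) (-2 * (4 * (k : MK3.CoordRing k) + 1)) ∧
      MK3.HasGenericClass A₂ (4 * MK3.coord k 1 ^ 2 + 1) (-2 * (4 * (k : MK3.CoordRing k) + 1)) ∧
      MK3.IsAlgebraicClass A₁ ∧ MK3.IsAlgebraicClass A₂ ∧
      Nonempty (MK3.AdelicPoints k) ∧
      MK3.brauerManinSet {A₁, A₂} = ∅ ∧
      IsEmpty (MK3.Points k ℤ) ∧
      ∀ P : MK3.AdelicPoints k, ∃ A ∈ ({A₁, A₂} : Set (MK3.AzumayaAlgebra (MK3.CoordRing k))),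
        MK3.invInf A P = 0 ∧
        ∀ p : Nat.Primes, MK3.invFin A P p =
          if (p : ℕ) = 3 then ((1 / 2 : ℚ) : AddCircle (1 : ℚ)) else 0 := by
  have hk' : 4 * k + 1 = -27 * ℓ ^ 2 := by
    have : (4 * k + 1 : ℚ) = -27 * ℓ ^ 2 := by rw [hk]; ring
    exact_mod_cast this
  have hℓ : ℓ ≠ 0 := by
    rintro rfl
    rcases h8 with h | h <;> exact absurd h (by decide)
  have h3 : k % 3 = 2 := by omega
  have h4 : k % 4 = 1 := by
    -- With ℓ² = 16m + 1, the relation 4k + 1 = -27ℓ² gives k = -7 - 108m, which is 1 modulo 4.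
    obtain ⟨m, hm⟩ : ∃ m, ℓ ^ 2 = 16 * m + 1 := by
      rcases h8 with h | h
      · obtain ⟨n, hn⟩ := h.symm.dvd
        exact ⟨4 * n ^ 2 + n, by rw [show ℓ = 8 * n + 1 by omega]; ring⟩
      · obtain ⟨n, hn⟩ := h.symm.dvd
        exact ⟨4 * n ^ 2 - n, by rw [show ℓ = 8 * n - 1 by omega]; ring⟩
    omega
  have hinv (P : MK3.AdelicPoints k) : ∃ A ∈ ({MK3.surfaceAlgebra k 0, MK3.surfaceAlgebra k 1} :
      Set (MK3.AzumayaAlgebra (MK3.CoordRing k))), MK3.invInf A P = 0 ∧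
        ∀ p : Nat.Primes, MK3.invFin A P p =
          if (p : ℕ) = 3 then ((1 / 2 : ℚ) : AddCircle (1 : ℚ)) else 0 := by
    obtain ⟨i, hi, heven⟩ : ∃ i : Fin 3, (i = 0 ∨ i = 1) ∧
        2 ∣ (P.fin ⟨2, Nat.prime_two⟩).1 i :=
      (MK3.exists_two_dvd h4 (P.fin ⟨2, Nat.prime_two⟩)).elim (fun h => ⟨0, .inl rfl, h⟩)
        (fun h => ⟨1, .inr rfl, h⟩)
    refine ⟨MK3.surfaceAlgebra k i, by rcases hi with rfl | rfl <;> simp,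
      MK3.invInf_surfaceAlgebra P i, fun ⟨p, hp⟩ => ?_⟩
    change MK3.invFin _ _ _ = if p = 3 then _ else _
    split_ifs with hp3
    · subst hp3
      exact MK3.localInv_three _ i hℓ hk' h3
    · by_cases hp2 : p = 2
      · subst hp2
        exact MK3.localInv_two _ i hℓ hk' heven
      · have : Fact p.Prime := ⟨hp⟩
        exact MK3.localInv_padic_of_five_le (p := p) _ i hp2 hp3 hℓ hk' hprime
  refine ⟨MK3.surfaceAlgebra k 0, MK3.surfaceAlgebra k 1, MK3.hasGenericClass_surfaceAlgebra k 0,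
    MK3.hasGenericClass_surfaceAlgebra k 1, MK3.isAlgebraicClass_surfaceAlgebra k 0,
    MK3.isAlgebraicClass_surfaceAlgebra k 1, ?_, ?_, MK3.isEmpty_points_int hk' h4 h3 hprime, hinv⟩
  · have hp (p : Nat.Primes) : Nonempty (MK3.Points k ℤ_[(p : ℕ)]) := by
      obtain ⟨p, hp⟩ := p
      by_cases hp2 : p = 2
      · subst hp2
        exact MK3.nonempty_points_two h4
      · have : Fact p.Prime := ⟨hp⟩
        exact MK3.nonempty_points_odd (p := p) k hp2
    obtain ⟨P⟩ := MK3.nonempty_points_real (k := k) (by nlinarith [sq_nonneg ℓ])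
    exact ⟨⟨fun p => (hp p).some, P⟩⟩
  · refine Set.eq_empty_of_forall_notMem fun P hP => ?_
    obtain ⟨A, hA, hinf, hfin⟩ := hinv P
    exact MK3.pairing_ne_zero hinf hfin (hP A (.of A hA))
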